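/- Let $\mathscr H$ be a complex Hilbert space and, for $1<p<\infty$, let $\mathbb B_p(\mathscr H)$ be the Schatten $p$-class, i.e. the compact operators $T$ on $\mathscr H$ whose singular values $s_j(T)$ (the square roots of the eigenvalues of $T^*T$, counted with multiplicity) satisfy $\|T\|_p=\big(\sum_j s_j(T)^p\big)^{1/p}<\infty$. Let $q$ be the conjugate exponent of $p$, $\frac1p+\frac1q=1$. Let $Q=(q_{ij})$ be a real suborthogonal $s\times t$ matrix, that is, a real matrix with orthonormal columns, $Q^TQ=I_t$. Let $X_1,\dots,X_s,Y_1,\dots,Y_t\in\mathbb B_p(\mathscr H)$ satisfy $(X_1,\dots,X_s)^T=Q(Y_1,\dots,Y_t)^T$, that is, $X_i=\sum_{j=1}^t q_{ij}Y_j$ for $i=1,\dots,s$. If $1<p\le 2$, then $$\sum_{i=1}^s\|X_i\|_p^q\le\Big(\max_{i,j}|q_{ij}|\Big)^{\frac qp-1}\Big(\sum_{j=1}^t\|Y_j\|_p^p\Big)^{\frac qp}.$$ If $2\le p<\infty$, then the reverse inequality holds: $$\sum_{i=1}^s\|X_i\|_p^q\ge\Big(\max_{i,j}|q_{ij}|\Big)^{\frac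 qp-1}\Big(\sum_{j=1}^t\|Y_j\|_p^p\Big)^{\frac qp}.$$ -/

import Mathlib

noncomputable section SchattenClass

variable {H : Type*} [NormedAddCommGroup H] [InnerProductSpace ℂ H] [CompleteSpace H]

/-- The multiplicity of `σ > 0` as a singular value of `T`. The singular values of `T` are the
square roots of the eigenvalues of `T* T`, so this is the dimension of the eigenspace of `T* T` for
the eigenvalue `σ ^ 2` (it is finite when `T` is compact, and `0` if `σ` is no singular value). -/
def singularValueMultiplicity (T : H →L[ℂ] H) (σ : ℝ) : ℕ :=
  Module.finrank ℂ
    (Module.End.eigenspace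
      ((ContinuousLinearMap.adjoint T ∘L T : H →L[ℂ] H) : H →ₗ[ℂ] H) ((σ ^ 2 : ℝ) : ℂ))

/-- The sum `∑ⱼ sⱼ(T) ^ p` of the `p`-th powers of the (nonzero) singular values of the compact
operator `T`, each repeated according to its multiplicity, as an element of `[0, ∞]`. -/
def schattenSum (p : ℝ) (T : H →L[ℂ] H) : ENNReal :=
  ∑' σ : {σ : ℝ // 0 < σ},
    (singularValueMultiplicity T σ : ENNReal) * ENNReal.ofReal ((σ : ℝ) ^ p)

variable (H) in
/-- The Schatten `p`-class: the compact operators `T` on `H` with `∑ⱼ sⱼ(T) ^ p < ∞`. -/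
def schattenClass (p : ℝ) : Set (H →L[ℂ] H) :=
  {T | IsCompactOperator T ∧ schattenSum p T < ⊤}

/-- The Schatten `p`-norm `‖T‖_p = (∑ⱼ sⱼ(T) ^ p) ^ (1 / p)` of an operator in the Schatten
`p`-class. -/
def schattenNorm (p : ℝ) (T : H →L[ℂ] H) : ℝ :=
  (schattenSum p T).toReal ^ (1 / p)

end SchattenClass

/-- A real suborthogonal `s × t` matrix: its columns are orthonormal. -/
def IsSuborthogonal {s t : ℕ} (Q : Matrix (Fin s) (Fin t) ℝ) : Prop :=
  Q.transpose * Q = 1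

/-- The maximum of the moduli of the entries of a real matrix. -/
noncomputable def maxAbsEntry {s t : ℕ} (Q : Matrix (Fin s) (Fin t) ℝ) : ℝ :=
  ⨆ ij : Fin s × Fin t, |Q ij.1 ij.2|

open Filter
open scoped TensorProduct InnerProductSpace

open Complex in
/-- Riesz–Thorin interpolation for a bilinear form. -/
theorem norm_bilinear_le_interp {α β ι : Type*} [Fintype ι] [DecidableEq ι]
    (A : Finset α) (B : Finset β) (i : β → ι) (M : β → α → ℂ) {m : ℝ} (hm : 0 ≤ m)
    (h₁ : ∀ a ∈ A, ∀ k, ∑ b ∈ B with i b = k, ‖M b a‖ ≤ m)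
    (h₂ : ∀ (z : β → ℂ) (y : α → ℂ), ‖∑ b ∈ B, ∑ a ∈ A, z b * y a * M b a‖ ≤
      √(∑ b ∈ B, ‖z b‖ ^ 2) * √(∑ a ∈ A, ‖y a‖ ^ 2))
    {p q : ℝ} (hpq : p.HolderConjugate q) (hp : p ≤ 2)
    {y : α → ℝ} (hy : ∀ a, 0 < y a) {z : β → ℝ} (hz : ∀ b ∈ B, 0 < z b) :
    ‖∑ b ∈ B, ∑ a ∈ A, (z b : ℂ) * y a * M b a‖ ≤ m ^ (2 / p - 1) *
      (∑ a ∈ A, y a ^ p) ^ (1 / p) *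
      (∑ k, (∑ b ∈ B with i b = k, z b ^ q) ^ (p / q)) ^ (1 / p) := by
  have hp0 : 0 < p := hpq.pos
  have hq0 : 0 < q := hpq.symm.pos
  have hinv : 1 / p + 1 / q = 1 := by simpa using hpq.inv_add_inv_eq_one
  have hq : 2 ≤ q := by
    have h : 1 / 2 ≤ 1 / p := one_div_le_one_div_of_le hp0 hp
    have h' : 1 / q ≤ 1 / 2 := by linarith
    exact (one_div_le_one_div hq0 two_pos).1 h'
  set G : ι → ℝ := fun k => ∑ b ∈ B with i b = k, z b ^ q with hG
  have hG0 : ∀ k, 0 ≤ G k := fun k =>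
    Finset.sum_nonneg fun b hb => Real.rpow_nonneg (hz b (Finset.mem_filter.1 hb).1).le _
  have hGpos : ∀ b ∈ B, 0 < G (i b) := fun b hb =>
    Finset.sum_pos' (fun b hb => Real.rpow_nonneg (hz b (Finset.mem_filter.1 hb).1).le _)
      ⟨b, by simp [hb], Real.rpow_pos_of_pos (hz b hb) _⟩
  set P : ℝ := ∑ a ∈ A, y a ^ p with hP
  set R : ℝ := ∑ k, G k ^ (p / q) with hR
  have hP0 : 0 ≤ P := Finset.sum_nonneg fun a _ => Real.rpow_nonneg (hy a).le _
  have hR0 : 0 ≤ R := Finset.sum_nonneg fun k _ => Real.rpow_nonneg (hG0 k) _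
  set zf : ℂ → β → ℂ := fun w b =>
    (z b : ℂ) ^ ((q / 2 : ℝ) * w) * (G (i b) : ℂ) ^ (((p / q : ℝ) : ℂ) - ((p + q) / (2 * q) : ℝ) * w)
    with hzf
  set yf : ℂ → α → ℂ := fun w a => (y a : ℂ) ^ ((p : ℂ) - (p / 2 : ℝ) * w) with hyf
  have hzn : ∀ w, ∀ b ∈ B, ‖zf w b‖ =
      z b ^ (q / 2 * w.re) * G (i b) ^ (p / q - (p + q) / (2 * q) * w.re) := by
    intro w b hb
    rw [hzf, norm_mul, norm_cpow_eq_rpow_re_of_pos (hz b hb),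
      norm_cpow_eq_rpow_re_of_pos (hGpos b hb)]
    simp only [re_ofReal_mul, sub_re, ofReal_re]
  have hyn : ∀ w a, ‖yf w a‖ = y a ^ (p - p / 2 * w.re) := by
    intro w a
    rw [hyf, norm_cpow_eq_rpow_re_of_pos (hy a)]
    simp only [re_ofReal_mul, sub_re, ofReal_re]
  set F : ℂ → ℂ := fun w => ∑ b ∈ B, ∑ a ∈ A, zf w b * yf w a * M b a with hF
  have hFn : ∀ w, ‖F w‖ ≤ ∑ b ∈ B, ∑ a ∈ A,
      z b ^ (q / 2 * w.re) * G (i b) ^ (p / q - (p + q) / (2 * q) * w.re) *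
        y a ^ (p - p / 2 * w.re) * ‖M b a‖ := by
    intro w
    refine (norm_sum_le _ _).trans (Finset.sum_le_sum fun b hb => ?_)
    refine (norm_sum_le _ _).trans (Finset.sum_le_sum fun a _ => ?_)
    rw [norm_mul, norm_mul, hzn w b hb, hyn]
  have hd : Differentiable ℂ F := by
    rw [hF]
    refine Differentiable.fun_sum fun b hb => Differentiable.fun_sum fun a _ => ?_
    refine ((Differentiable.mul ?_ ?_).mul ?_).mul_const _
    · exact Differentiable.const_cpow (by fun_prop) (Or.inl (by exact_mod_cast (hz b hb).ne'))
    · exact Differentiable.const_cpow (by fun_prop)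
        (Or.inl (by exact_mod_cast (hGpos b hb).ne'))
    · exact Differentiable.const_cpow (by fun_prop) (Or.inl (by exact_mod_cast (hy a).ne'))
  have hB : BddAbove ((norm ∘ F) '' HadamardThreeLines.verticalClosedStrip 0 1) := by
    have hc : ContinuousOn (fun x : ℝ => ∑ b ∈ B, ∑ a ∈ A,
        z b ^ (q / 2 * x) * G (i b) ^ (p / q - (p + q) / (2 * q) * x) *
          y a ^ (p - p / 2 * x) * ‖M b a‖) (Set.Icc 0 1) := by
      refine Continuous.continuousOn ?_
      refine continuous_finsetSum _ fun b hb => continuous_finsetSum _ fun a _ => ?_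
      refine ((Continuous.mul ?_ ?_).mul ?_).mul_const _
      · exact Continuous.rpow continuous_const (by fun_prop) fun _ => Or.inl (hz b hb).ne'
      · exact Continuous.rpow continuous_const (by fun_prop) fun _ => Or.inl (hGpos b hb).ne'
      · exact Continuous.rpow continuous_const (by fun_prop) fun _ => Or.inl (hy a).ne'
    obtain ⟨C, hC⟩ := isCompact_Icc.bddAbove_image hc
    refine ⟨C, ?_⟩
    rintro _ ⟨w, hw, rfl⟩
    exact (hFn w).trans (hC ⟨w.re, hw, rfl⟩)
  have hleft : ∀ w ∈ re ⁻¹' ({0} : Set ℝ), ‖F w‖ ≤ m * P * R := by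
    intro w hw
    have hw : w.re = 0 := hw
    refine (hFn w).trans ?_
    simp only [hw, mul_zero, sub_zero, Real.rpow_zero, one_mul]
    rw [Finset.sum_comm, mul_assoc, mul_left_comm, hP, Finset.sum_mul]
    refine Finset.sum_le_sum fun a ha => ?_
    rw [← Finset.sum_fiberwise B i, hR, Finset.mul_sum, Finset.mul_sum]
    refine Finset.sum_le_sum fun k _ => ?_
    calc ∑ b ∈ B with i b = k, G (i b) ^ (p / q) * y a ^ p * ‖M b a‖
        = ∑ b ∈ B with i b = k, G k ^ (p / q) * y a ^ p * ‖M b a‖ :=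
          Finset.sum_congr rfl fun b hb => by rw [(Finset.mem_filter.1 hb).2]
      _ = G k ^ (p / q) * y a ^ p * ∑ b ∈ B with i b = k, ‖M b a‖ := (Finset.mul_sum ..).symm
      _ ≤ G k ^ (p / q) * y a ^ p * m :=
          mul_le_mul_of_nonneg_left (h₁ a ha k)
            (mul_nonneg (Real.rpow_nonneg (hG0 k) _) (Real.rpow_nonneg (hy a).le _))
      _ = y a ^ p * (m * G k ^ (p / q)) := by ring
  have hright : ∀ w ∈ re ⁻¹' ({1} : Set ℝ), ‖F w‖ ≤ √R * √P := by
    intro w hw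
    have hw : w.re = 1 := hw
    refine (h₂ (zf w) (yf w)).trans (le_of_eq ?_)
    congr 2
    · rw [← Finset.sum_fiberwise B i, hR]
      refine Finset.sum_congr rfl fun k _ => ?_
      have hterm : ∀ b ∈ B.filter (i · = k), ‖zf w b‖ ^ 2 = z b ^ q * G k ^ (p / q - 1) := by
        intro b hb
        obtain ⟨hb', rfl⟩ := Finset.mem_filter.1 hb
        rw [hzn w b hb', hw, mul_pow, ← Real.rpow_mul_natCast (hz b hb').le,
          ← Real.rpow_mul_natCast (hG0 _)]
        congr 2
        · push_cast; ring
        · push_cast; field_simp; ring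
      rw [Finset.sum_congr rfl hterm, ← Finset.sum_mul]
      change G k * _ = _
      rcases (hG0 k).eq_or_lt with h | h
      · rw [← h, zero_mul, Real.zero_rpow (div_pos hp0 hq0).ne']
      · rw [Real.rpow_sub_one h.ne', mul_div_cancel₀ _ h.ne']
    · rw [hP]
      refine Finset.sum_congr rfl fun a _ => ?_
      rw [hyn, hw, ← Real.rpow_mul_natCast (hy a).le]
      congr 1
      push_cast; ring
  have hθ : ((2 / q : ℝ) : ℂ) ∈ HadamardThreeLines.verticalClosedStrip 0 1 := by
    refine ⟨?_, ?_⟩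
    · rw [ofReal_re]; positivity
    · rw [ofReal_re]; exact (div_le_one hq0).2 hq
  have key := HadamardThreeLines.norm_le_interp_of_mem_verticalClosedStrip₀₁' F hθ
    hd.diffContOnCl hB hleft hright
  have hFθ : F ((2 / q : ℝ) : ℂ) = ∑ b ∈ B, ∑ a ∈ A, (z b : ℂ) * y a * M b a := by
    rw [hF]
    refine Finset.sum_congr rfl fun b hb => Finset.sum_congr rfl fun a _ => ?_
    have e1 : ((q / 2 : ℝ) : ℂ) * ((2 / q : ℝ) : ℂ) = 1 := by
      rw [← ofReal_mul, ← ofReal_one]; congr 1; field_simp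
    have e2 : ((p / q : ℝ) : ℂ) - ((p + q) / (2 * q) : ℝ) * ((2 / q : ℝ) : ℂ) = 0 := by
      rw [← ofReal_mul, ← ofReal_sub, ← ofReal_zero]; congr 1
      have := hpq.mul_eq_add
      field_simp
      linarith
    have e3 : (p : ℂ) - (p / 2 : ℝ) * ((2 / q : ℝ) : ℂ) = 1 := by
      rw [← ofReal_mul, ← ofReal_sub, ← ofReal_one]; congr 1
      have := hpq.mul_eq_add
      field_simp
      linarith
    simp only [hzf, hyf, e1, e2, e3, cpow_one, cpow_zero, mul_one]
  rw [hFθ, ofReal_re] at key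
  refine key.trans (le_of_eq ?_)
  have t1 : 1 - 2 / q = 2 / p - 1 := by
    have : 2 / q = 2 * (1 / q) := by ring
    have : 2 / p = 2 * (1 / p) := by ring
    linarith
  have t2 : 2 / p - 1 + 1 / 2 * (2 / q) = 1 / p := by
    have : 1 / 2 * (2 / q) = 1 / q := by field_simp
    have : 2 / p = 2 * (1 / p) := by ring
    linarith
  have hadd : ∀ x : ℝ, 0 ≤ x → x ^ (2 / p - 1) * √x ^ (2 / q) = x ^ (1 / p) := by
    intro x hx
    rw [Real.sqrt_eq_rpow, ← Real.rpow_mul hx, ← t2, Real.rpow_add_of_nonneg hx]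
    · rw [← t1]
      have := (div_le_one hq0).2 hq
      linarith
    · positivity
  rw [t1, Real.mul_rpow (mul_nonneg hm hP0) hR0, Real.mul_rpow hm hP0,
    Real.mul_rpow (Real.sqrt_nonneg _) (Real.sqrt_nonneg _), ← hadd P hP0, ← hadd R hR0]
  ring

universe w in
/-- A Hilbert–Schmidt pairing of rank-one operators. -/
theorem exists_rankOne_pairing (H : Type w) [NormedAddCommGroup H] [InnerProductSpace ℂ H]
    [CompleteSpace H] : ∃ (E : Type w) (_ : NormedAddCommGroup E) (_ : InnerProductSpace ℂ E)
      (φ : H → H → E), ∀ e f u v : H, ⟪φ e f, φ u v⟫_ℂ = ⟪e, u⟫_ℂ * ⟪v, f⟫_ℂ := by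
  obtain ⟨w, b, -⟩ := exists_hilbertBasis ℂ H
  refine ⟨H ⊗[ℂ] lp (fun _ : w => ℂ) 2, inferInstance, inferInstance,
    fun e f => e ⊗ₜ star (b.repr f), fun e f u v => ?_⟩
  rw [TensorProduct.inner_tmul, ← b.repr.inner_map_map v f, lp.inner_eq_tsum, lp.inner_eq_tsum]
  simp [mul_comm]

theorem sum_mul_of_isSuborthogonal {s t : ℕ} {Q : Matrix (Fin s) (Fin t) ℝ}
    (hQ : IsSuborthogonal Q) (j k : Fin t) :
    ∑ i, (Q i j : ℂ) * (Q i k : ℂ) = if j = k then 1 else 0 := by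
  have h := congrFun (congrFun hQ j) k
  rw [Matrix.mul_apply, Matrix.one_apply] at h
  simp only [Matrix.transpose_apply] at h
  rw [← Complex.ofReal_inj] at h
  push_cast at h
  rw [h]
  split_ifs <;> simp

theorem sum_norm_sq_suborthogonal {E : Type*} [NormedAddCommGroup E] [InnerProductSpace ℂ E]
    {s t : ℕ} {Q : Matrix (Fin s) (Fin t) ℝ} (hQ : IsSuborthogonal Q) (y : Fin t → E) :
    ∑ i, ‖∑ j, ((Q i j : ℝ) : ℂ) • y j‖ ^ 2 = ∑ j, ‖y j‖ ^ 2 := by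
  have h : ((∑ i, ‖∑ j, ((Q i j : ℝ) : ℂ) • y j‖ ^ 2 : ℝ) : ℂ) = ((∑ j, ‖y j‖ ^ 2 : ℝ) : ℂ) := by
    push_cast
    simp only [← inner_self_eq_norm_sq_to_K (𝕜 := ℂ), ← Complex.coe_algebraMap]
    calc ∑ i, ⟪∑ j, ((Q i j : ℝ) : ℂ) • y j, ∑ j, ((Q i j : ℝ) : ℂ) • y j⟫_ℂ
        = ∑ i, ∑ j, ∑ k, (Q i j : ℂ) * (Q i k : ℂ) * ⟪y j, y k⟫_ℂ := by
          refine Finset.sum_congr rfl fun i _ => ?_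
          rw [sum_inner]
          refine Finset.sum_congr rfl fun j _ => ?_
          rw [inner_sum]
          refine Finset.sum_congr rfl fun k _ => ?_
          rw [inner_smul_left, inner_smul_right, Complex.conj_ofReal, mul_assoc]
      _ = ∑ j, ∑ k, (∑ i, (Q i j : ℂ) * (Q i k : ℂ)) * ⟪y j, y k⟫_ℂ := by
          rw [Finset.sum_comm]
          refine Finset.sum_congr rfl fun j _ => ?_
          rw [Finset.sum_comm]
          simp only [Finset.sum_mul]
      _ = ∑ j, ⟪y j, y j⟫_ℂ := by simp [sum_mul_of_isSuborthogonal hQ]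
  exact_mod_cast h

theorem norm_sq_sum_smul_of_orthonormal {E α : Type*} [NormedAddCommGroup E]
    [InnerProductSpace ℂ E] (A : Finset α) {x : α → E}
    (hx : ∀ a ∈ A, ∀ b ∈ A, a ≠ b → ⟪x a, x b⟫_ℂ = 0) (hx1 : ∀ a ∈ A, ⟪x a, x a⟫_ℂ = 1) (c : α → ℂ) :
    ‖∑ a ∈ A, c a • x a‖ ^ 2 = ∑ a ∈ A, ‖c a‖ ^ 2 := by
  classical
  have h : ((‖∑ a ∈ A, c a • x a‖ ^ 2 : ℝ) : ℂ) = ((∑ a ∈ A, ‖c a‖ ^ 2 : ℝ) : ℂ) := by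
    push_cast
    rw [← Complex.coe_algebraMap, ← inner_self_eq_norm_sq_to_K (𝕜 := ℂ), sum_inner]
    refine Finset.sum_congr rfl fun a ha => ?_
    rw [inner_sum, Finset.sum_eq_single_of_mem a ha]
    · rw [inner_smul_left, inner_smul_right, hx1 a ha, mul_one, Complex.conj_mul']
      rfl
    · intro b hb hba
      rw [inner_smul_left, inner_smul_right, hx a ha b hb hba.symm, mul_zero, mul_zero]
  exact_mod_cast h

section Gram
variable {H : Type*} [NormedAddCommGroup H] [InnerProductSpace ℂ H]
  {s t : ℕ} {Q : Matrix (Fin s) (Fin t) ℝ} {α β : Type*} {i : β → Fin s} {j : α → Fin t}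
  {u v : α → H} {e f : β → H}

theorem abs_le_maxAbsEntry (Q : Matrix (Fin s) (Fin t) ℝ) (i : Fin s) (j : Fin t) :
    |Q i j| ≤ maxAbsEntry Q :=
  le_ciSup (f := fun ij : Fin s × Fin t => |Q ij.1 ij.2|) (Set.finite_range _).bddAbove (i, j)

theorem maxAbsEntry_nonneg (Q : Matrix (Fin s) (Fin t) ℝ) : 0 ≤ maxAbsEntry Q :=
  Real.iSup_nonneg fun _ => abs_nonneg _

/-- `x` restricts to an orthonormal family on each fibre of `j`. -/
def FiberwiseOrthonormal {ι : Type*} (j : α → ι) (x : α → H) : Prop :=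
  ∀ k, Orthonormal ℂ fun a : {a // j a = k} => x a

theorem fiberwiseOrthonormal_sigma {ι : Type*} {κ : ι → Type*} {x : ∀ k, κ k → H}
    (h : ∀ k, Orthonormal ℂ (x k)) :
    FiberwiseOrthonormal Sigma.fst fun a : Σ k, κ k => x a.1 a.2 := by
  intro k
  refine ⟨fun a => (h _).1 _, ?_⟩
  rintro ⟨⟨k, a⟩, rfl⟩ ⟨⟨l, b⟩, hl⟩ hab
  obtain rfl : l = k := hl
  exact (h l).2 fun h => hab (Subtype.ext (congrArg (Sigma.mk l) h))

theorem FiberwiseOrthonormal.inner_self {ι : Type*} {j : α → ι} {x : α → H}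
    (hx : FiberwiseOrthonormal j x) (a : α) : ⟪x a, x a⟫_ℂ = 1 := by
  rw [inner_self_eq_norm_sq_to_K, (hx (j a)).1 ⟨a, rfl⟩]; simp

theorem FiberwiseOrthonormal.norm_eq_one {ι : Type*} {j : α → ι} {x : α → H}
    (hx : FiberwiseOrthonormal j x) (a : α) : ‖x a‖ = 1 := (hx (j a)).1 ⟨a, rfl⟩

theorem FiberwiseOrthonormal.inner_eq_zero {ι : Type*} {j : α → ι} {x : α → H}
    (hx : FiberwiseOrthonormal j x) {a b : α} (hab : a ≠ b) (hj : j a = j b) :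
    ⟪x a, x b⟫_ℂ = 0 :=
  (hx (j b)).2 (i := ⟨a, hj⟩) (j := ⟨b, rfl⟩) fun h => hab (congrArg Subtype.val h)

theorem FiberwiseOrthonormal.bessel {ι : Type*} [DecidableEq ι] {i : β → ι} {e : β → H}
    (he : FiberwiseOrthonormal i e) (B : Finset β) (k : ι) (x : H) :
    ∑ b ∈ B with i b = k, ‖⟪e b, x⟫_ℂ‖ ^ 2 ≤ ‖x‖ ^ 2 := by
  have h := (he k).sum_inner_products_le x (s := B.subtype fun b => i b = k)
  rwa [Finset.sum_subtype_eq_sum_filter (f := fun b => ‖⟪e b, x⟫_ℂ‖ ^ 2)] at h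

/-- The matrix of the bilinear form `∑ q i j * trace (Z i * Y j)` in terms of singular vectors. -/
noncomputable def gramKernel (Q : Matrix (Fin s) (Fin t) ℝ) (i : β → Fin s) (j : α → Fin t)
    (u v : α → H) (e f : β → H) (b : β) (a : α) : ℂ :=
  (Q (i b) (j a) : ℂ) * (⟪e b, u a⟫_ℂ * ⟪v a, f b⟫_ℂ)

theorem sum_norm_gramKernel_le (hu : FiberwiseOrthonormal j u) (hv : FiberwiseOrthonormal j v)
    (he : FiberwiseOrthonormal i e) (hf : FiberwiseOrthonormal i f) (B : Finset β) (a : α)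
    (k : Fin s) :
    ∑ b ∈ B with i b = k, ‖gramKernel Q i j u v e f b a‖ ≤ maxAbsEntry Q := by
  have h : ∀ b ∈ B.filter (i · = k), ‖gramKernel Q i j u v e f b a‖ ≤
      maxAbsEntry Q * (‖⟪e b, u a⟫_ℂ‖ * ‖⟪f b, v a⟫_ℂ‖) := by
    intro b _
    rw [gramKernel, norm_mul, norm_mul, Complex.norm_real, Real.norm_eq_abs,
      norm_inner_symm (v a) (f b)]
    exact mul_le_mul_of_nonneg_right (abs_le_maxAbsEntry Q _ _) (by positivity)
  refine (Finset.sum_le_sum h).trans ?_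
  rw [← Finset.mul_sum]
  refine mul_le_of_le_one_right (maxAbsEntry_nonneg Q) ?_
  refine (Real.sum_mul_le_sqrt_mul_sqrt _ _ _).trans ?_
  have h1 := he.bessel B k (u a)
  have h2 := hf.bessel B k (v a)
  rw [hu.norm_eq_one, one_pow] at h1
  rw [hv.norm_eq_one, one_pow] at h2
  exact mul_le_one₀ (Real.sqrt_le_one.2 h1) (Real.sqrt_nonneg _) (Real.sqrt_le_one.2 h2)

theorem norm_sum_gramKernel_le [CompleteSpace H] (hQ : IsSuborthogonal Q)
    (hu : FiberwiseOrthonormal j u) (hv : FiberwiseOrthonormal j v)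
    (he : FiberwiseOrthonormal i e) (hf : FiberwiseOrthonormal i f) (A : Finset α) (B : Finset β)
    (z : β → ℂ) (y : α → ℂ) :
    ‖∑ b ∈ B, ∑ a ∈ A, z b * y a * gramKernel Q i j u v e f b a‖ ≤
      √(∑ b ∈ B, ‖z b‖ ^ 2) * √(∑ a ∈ A, ‖y a‖ ^ 2) := by
  obtain ⟨E, _, _, φ, hφ⟩ := exists_rankOne_pairing H
  let Y := fun k => ∑ a ∈ A with j a = k, y a • φ (u a) (v a)
  let Z := fun k => ∑ b ∈ B with i b = k, (starRingEnd ℂ (z b)) • φ (e b) (f b)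
  have hY : ∑ k, ‖Y k‖ ^ 2 = ∑ a ∈ A, ‖y a‖ ^ 2 := by
    rw [← Finset.sum_fiberwise A j]
    refine Finset.sum_congr rfl fun k _ => norm_sq_sum_smul_of_orthonormal _ ?_ ?_ _
    · intro a ha b hb hab
      rw [hφ, hu.inner_eq_zero hab, zero_mul]
      rw [(Finset.mem_filter.1 ha).2, (Finset.mem_filter.1 hb).2]
    · intro a _
      rw [hφ, hu.inner_self, hv.inner_self, one_mul]
  have hZ : ∑ k, ‖Z k‖ ^ 2 = ∑ b ∈ B, ‖z b‖ ^ 2 := by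
    rw [← Finset.sum_fiberwise B i]
    refine Finset.sum_congr rfl fun k _ =>
      (norm_sq_sum_smul_of_orthonormal _ ?_ ?_ _).trans ?_
    · intro a ha b hb hab
      rw [hφ, he.inner_eq_zero hab, zero_mul]
      rw [(Finset.mem_filter.1 ha).2, (Finset.mem_filter.1 hb).2]
    · intro a _
      rw [hφ, he.inner_self, hf.inner_self, one_mul]
    · simp only [RCLike.norm_conj]
  have hS : ∑ b ∈ B, ∑ a ∈ A, z b * y a * gramKernel Q i j u v e f b a =
      ∑ k, ⟪Z k, ∑ l, ((Q k l : ℝ) : ℂ) • Y l⟫_ℂ := by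
    rw [← Finset.sum_fiberwise B i]
    refine Finset.sum_congr rfl fun k _ => ?_
    rw [sum_inner]
    refine Finset.sum_congr rfl fun b hb => ?_
    rw [← Finset.sum_fiberwise A j, inner_sum]
    refine Finset.sum_congr rfl fun l _ => ?_
    rw [inner_smul_right (𝕜 := ℂ) _ (Y l) ((Q k l : ℝ) : ℂ), inner_sum, Finset.mul_sum]
    refine Finset.sum_congr rfl fun a ha => ?_
    rw [inner_smul_left, inner_smul_right, hφ, gramKernel, (Finset.mem_filter.1 ha).2,
      (Finset.mem_filter.1 hb).2, Complex.conj_conj]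
    ring
  rw [hS, ← hY, ← hZ, ← sum_norm_sq_suborthogonal hQ Y]
  exact (norm_sum_le _ _).trans ((Finset.sum_le_sum fun k _ => norm_inner_le_norm (𝕜 := ℂ) _ _).trans
    (Real.sum_mul_le_sqrt_mul_sqrt _ _ _))
end Gram

section SingularValueDecomposition
variable {H : Type*} [NormedAddCommGroup H] [InnerProductSpace ℂ H] [CompleteSpace H]

/-- The positive singular values of `T`, repeated according to their multiplicity. -/
abbrev SingularIndex (T : H →L[ℂ] H) : Type :=
  Σ σ : {σ : ℝ // 0 < σ}, Fin (singularValueMultiplicity T σ)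

theorem schattenSum_eq_tsum_singularIndex (T : H →L[ℂ] H) (p : ℝ) :
    schattenSum p T = ∑' k : SingularIndex T, ENNReal.ofReal ((k.1 : ℝ) ^ p) := by
  rw [schattenSum, ENNReal.tsum_sigma' fun k : SingularIndex T => ENNReal.ofReal ((k.1 : ℝ) ^ p)]
  refine tsum_congr fun σ => ?_
  simp

/-- The right singular vectors of a compact operator. -/
theorem exists_rightSingularVectors {T : H →L[ℂ] H} (hT : IsCompactOperator T) :
    ∃ f : SingularIndex T → H, Orthonormal ℂ f ∧
      (∀ k, ContinuousLinearMap.adjoint T (T (f k)) = (((k.1 : ℝ) ^ 2 : ℝ) : ℂ) • f k) ∧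
      ∀ x, (∀ k, ⟪f k, x⟫_ℂ = 0) → T x = 0 := by
  set A : H →L[ℂ] H := ContinuousLinearMap.adjoint T ∘L T with hA
  have hAc : IsCompactOperator A := hT.clm_comp (ContinuousLinearMap.adjoint T)
  have hAs : (A : H →ₗ[ℂ] H).IsSymmetric := fun x y => by
    change ⟪ContinuousLinearMap.adjoint T (T x), y⟫_ℂ = ⟪x, ContinuousLinearMap.adjoint T (T y)⟫_ℂ
    rw [ContinuousLinearMap.adjoint_inner_left, ContinuousLinearMap.adjoint_inner_right]
  let E : {σ : ℝ // 0 < σ} → Submodule ℂ H := fun σ =>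
    Module.End.eigenspace (A : H →ₗ[ℂ] H) (((σ : ℝ) ^ 2 : ℝ) : ℂ)
  have hfin : ∀ σ : {σ : ℝ // 0 < σ}, FiniteDimensional ℂ (E σ) := fun σ =>
    ContinuousLinearMap.finite_dimensional_eigenspace hAc _
      (by exact_mod_cast (pow_pos σ.2 2).ne')
  let b : ∀ σ : {σ : ℝ // 0 < σ}, OrthonormalBasis (Fin (singularValueMultiplicity T σ)) ℂ (E σ) := fun σ =>
    stdOrthonormalBasis ℂ (E σ)
  have hE : OrthogonalFamily ℂ (fun σ => E σ) fun σ => (E σ).subtypeₗᵢ := by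
    refine hAs.orthogonalFamily_eigenspaces.comp
      (f := fun σ : {σ : ℝ // 0 < σ} => (((σ : ℝ) ^ 2 : ℝ) : ℂ)) fun σ τ h => ?_
    have h' : (σ : ℝ) ^ 2 = (τ : ℝ) ^ 2 := Complex.ofReal_injective h
    exact Subtype.ext ((pow_left_inj₀ σ.2.le τ.2.le two_ne_zero).1 h')
  refine ⟨fun k => b k.1 k.2, hE.orthonormal_sigma_orthonormal fun σ => (b σ).orthonormal,
    fun k => Module.End.mem_eigenspace_iff.1 (b k.1 k.2).2, fun x hx => ?_⟩
  have hxE : ∀ σ : {σ : ℝ // 0 < σ}, ∀ w ∈ E σ, ⟪w, x⟫_ℂ = 0 := by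
    intro σ w hw
    have h := (b σ).sum_repr ⟨w, hw⟩
    have h' : w = ∑ l, (b σ).repr ⟨w, hw⟩ l • (b σ l : H) := by
      have := congrArg (Subtype.val) h
      simpa using this.symm
    rw [h', sum_inner]
    exact Finset.sum_eq_zero fun l _ => by rw [inner_smul_left, hx ⟨σ, l⟩, mul_zero]
  let K := LinearMap.ker (A : H →ₗ[ℂ] H)
  have hKc : IsClosed (K : Set H) := A.isClosed_ker
  have : CompleteSpace K := hKc.completeSpace_coe
  obtain ⟨a, ha, c, hc, hac⟩ := K.exists_add_mem_mem_orthogonal x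
  have hTa : T a = 0 := by
    have h0 : A a = 0 := ha
    have : ⟪A a, a⟫_ℂ = ⟪T a, T a⟫_ℂ := ContinuousLinearMap.adjoint_inner_left T a (T a)
    rw [h0, inner_zero_left] at this
    exact inner_self_eq_zero.1 this.symm
  have hc0 : c = 0 := by
    have hmem : c ∈ (⨆ μ, Module.End.eigenspace (A : H →ₗ[ℂ] H) μ)ᗮ := by
      rw [← Submodule.iInf_orthogonal, Submodule.mem_iInf]
      intro μ
      rw [Submodule.mem_orthogonal]
      intro w hw
      have hAw : A w = μ • w := Module.End.mem_eigenspace_iff.1 hw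
      by_cases hw0 : w = 0
      · rw [hw0, inner_zero_left]
      by_cases hμ : μ = 0
      · refine hc w ?_
        change A w = 0
        rw [hAw, hμ, zero_smul]
      have hn : (((‖T w‖ / ‖w‖) ^ 2 : ℝ) : ℂ) = μ := by
        have h1 : ⟪w, A w⟫_ℂ = ⟪T w, T w⟫_ℂ := ContinuousLinearMap.adjoint_inner_right T w (T w)
        rw [hAw, inner_smul_right, inner_self_eq_norm_sq_to_K, inner_self_eq_norm_sq_to_K] at h1
        have hw' : (‖w‖ : ℂ) ≠ 0 := by exact_mod_cast norm_ne_zero_iff.2 hw0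
        push_cast
        rw [div_pow, div_eq_iff (pow_ne_zero 2 hw')]
        exact h1.symm
      have hpos : 0 < ‖T w‖ / ‖w‖ := by
        refine lt_of_le_of_ne (by positivity) fun h => hμ ?_
        rw [← hn, ← h]; simp
      have hwE : w ∈ E ⟨_, hpos⟩ := by
        change w ∈ Module.End.eigenspace (A : H →ₗ[ℂ] H) (((‖T w‖ / ‖w‖) ^ 2 : ℝ) : ℂ)
        rwa [hn]
      have hwa : ⟪w, a⟫_ℂ = 0 := by
        have h1 : ⟪A w, a⟫_ℂ = ⟪w, A a⟫_ℂ := hAs w a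
        have h0 : A a = 0 := ha
        rw [hAw, h0, inner_zero_right, inner_smul_left] at h1
        exact (mul_eq_zero.1 h1).resolve_left (by simpa using hμ)
      have := hxE _ w hwE
      rwa [hac, inner_add_right, hwa, zero_add] at this
    rw [ContinuousLinearMap.orthogonalComplement_iSup_eigenspaces_eq_bot hAc hAs] at hmem
    exact hmem
  rw [hac, hc0, add_zero, hTa]

/-- The singular value decomposition of a compact operator. -/
theorem exists_singularValueDecomposition {T : H →L[ℂ] H} (hT : IsCompactOperator T) :
    ∃ e f : SingularIndex T → H, Orthonormal ℂ e ∧ Orthonormal ℂ f ∧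
      (∀ k, T (f k) = ((k.1 : ℝ) : ℂ) • e k) ∧
      ∀ x y, HasSum (fun k : SingularIndex T => ((k.1 : ℝ) : ℂ) * (⟪x, e k⟫_ℂ * ⟪f k, y⟫_ℂ))
        ⟪x, T y⟫_ℂ := by
  obtain ⟨f, hf, hTf, hker⟩ := exists_rightSingularVectors hT
  have hs : ∀ k : SingularIndex T, (((k.1 : ℝ) : ℂ)) ≠ 0 := fun k =>
    by exact_mod_cast k.1.2.ne'
  have hTe : ∀ k, T (f k) = ((k.1 : ℝ) : ℂ) • (((k.1 : ℝ) : ℂ)⁻¹ • T (f k)) := fun k => by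
    rw [smul_smul, mul_inv_cancel₀ (hs k), one_smul]
  refine ⟨fun k => ((k.1 : ℝ) : ℂ)⁻¹ • T (f k), f, ?_, hf, hTe, fun x y => ?_⟩
  · classical
    rw [orthonormal_iff_ite] at hf ⊢
    intro k l
    rw [inner_smul_left, inner_smul_right, ← ContinuousLinearMap.adjoint_inner_right, hTf,
      inner_smul_right, hf]
    split_ifs with h
    · subst h
      have := hs k
      simp only [map_inv₀, Complex.conj_ofReal]
      push_cast
      field_simp
    · simp
  · obtain ⟨w, b, hw, hb⟩ := hf.toSubtypeRange.exists_hilbertBasis_extension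
    let g : SingularIndex T → w := fun k => ⟨f k, hw ⟨k, rfl⟩⟩
    have hg : Function.Injective g := fun k l h =>
      hf.linearIndependent.injective (congrArg Subtype.val h)
    have h1 : HasSum (fun c : w => ⟪x, T c⟫_ℂ * ⟪(c : H), y⟫_ℂ) ⟪x, T y⟫_ℂ := by
      have h := ((innerSL ℂ x).comp T).hasSum (b.hasSum_repr y)
      refine h.congr_fun fun c => ?_
      simp only [map_smul, ContinuousLinearMap.comp_apply, innerSL_apply_apply, smul_eq_mul,
        b.repr_apply_apply, hb]
      ring
    have h2 := (hg.hasSum_iff (f := fun c : w => ⟪x, T c⟫_ℂ * ⟪(c : H), y⟫_ℂ)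
      (a := ⟪x, T y⟫_ℂ) ?_).2 h1
    · refine h2.congr_fun fun k => ?_
      simp only [Function.comp_apply, g]
      conv_rhs => rw [hTe k, inner_smul_right]
      ring
    · intro c hc
      have : T c = 0 := hker _ fun k => by
        have hne : g k ≠ c := fun h => hc ⟨k, h⟩
        have := b.orthonormal.2 hne
        simpa [hb, g] using this
      simp only [this, inner_zero_right, zero_mul]

theorem hasSum_schattenNorm {T : H →L[ℂ] H} {p : ℝ} (hp : 0 < p) (hT : T ∈ schattenClass H p) :
    HasSum (fun k : SingularIndex T => (k.1 : ℝ) ^ p) (schattenNorm p T ^ p) := by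
  have h0 : ∀ k : SingularIndex T, 0 ≤ (k.1 : ℝ) ^ p := fun k => Real.rpow_nonneg k.1.2.le _
  have hfin := hT.2
  rw [schattenSum_eq_tsum_singularIndex] at hfin
  have h := (ENNReal.summable_toReal hfin.ne).hasSum
  rw [← ENNReal.tsum_toReal_eq (fun _ => ENNReal.ofReal_ne_top),
    ← schattenSum_eq_tsum_singularIndex] at h
  simp only [ENNReal.toReal_ofReal (h0 _)] at h
  rwa [schattenNorm, ← Real.rpow_mul ENNReal.toReal_nonneg, one_div_mul_cancel hp.ne',
    Real.rpow_one]

theorem schattenNorm_nonneg (p : ℝ) (T : H →L[ℂ] H) : 0 ≤ schattenNorm p T :=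
  Real.rpow_nonneg ENNReal.toReal_nonneg _
end SingularValueDecomposition

section Sigma
variable {ι : Type*} {κ : ι → Type*}

theorem hasSum_sigma_ite [DecidableEq ι] {M : Type*} [AddCommMonoid M] [TopologicalSpace M]
    {g : (Σ k, κ k) → M} {k : ι} {c : M} (h : HasSum (fun a => g ⟨k, a⟩) c) :
    HasSum (fun a : Σ k, κ k => if a.1 = k then g a else 0) c := by
  refine ((sigma_mk_injective (i := k)).hasSum_iff ?_).1 ?_
  · rintro ⟨l, a⟩ hl
    refine if_neg ?_
    rintro rfl
    exact hl ⟨a, rfl⟩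
  · simpa [Function.comp_def] using h

theorem hasSum_sigma_fintype [Fintype ι] {M : Type*} [AddCommMonoid M] [TopologicalSpace M]
    [ContinuousAdd M] {g : (Σ k, κ k) → M} {c : ι → M}
    (h : ∀ k, HasSum (fun a => g ⟨k, a⟩) (c k)) : HasSum g (∑ k, c k) := by
  classical
  simpa using hasSum_sum fun k (_ : k ∈ Finset.univ) => hasSum_sigma_ite (h k)

theorem tendsto_sum_filter_sigma [DecidableEq ι] {g : (Σ k, κ k) → ℝ} {k : ι} {c : ℝ}
    (h : HasSum (fun a => g ⟨k, a⟩) c) :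
    Tendsto (fun B : Finset (Σ k, κ k) => ∑ b ∈ B with b.1 = k, g b) atTop (nhds c) := by
  have h' := hasSum_sigma_ite h
  rw [HasSum, SummationFilter.unconditional_filter] at h'
  simpa only [Finset.sum_filter] using h'

theorem sum_filter_sigma_le [DecidableEq ι] {g : (Σ k, κ k) → ℝ}
    (hg : ∀ a, 0 ≤ g a) {k : ι} {c : ℝ} (h : HasSum (fun a => g ⟨k, a⟩) c)
    (B : Finset (Σ k, κ k)) : ∑ b ∈ B with b.1 = k, g b ≤ c := by
  rw [Finset.sum_filter]
  refine sum_le_hasSum B (fun a _ => ?_) (hasSum_sigma_ite h)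
  split_ifs
  exacts [hg a, le_rfl]
end Sigma

theorem le_rpow_of_le_mul_rpow {p q S C : ℝ} (hpq : p.HolderConjugate q) (hS : 0 ≤ S)
    (hC : 0 ≤ C) (h : S ≤ C * S ^ (1 / p)) : S ≤ C ^ q := by
  rcases hS.eq_or_lt with rfl | hS
  · exact Real.rpow_nonneg hC _
  have hinv : 1 / p + 1 / q = 1 := by simpa using hpq.inv_add_inv_eq_one
  have h1 : S ^ (1 / q) ≤ C := by
    rw [show 1 / q = 1 - 1 / p by linarith, Real.rpow_sub hS, Real.rpow_one]
    exact (div_le_iff₀ (Real.rpow_pos_of_pos hS _)).2 h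
  calc S = (S ^ (1 / q)) ^ q := by
        rw [← Real.rpow_mul hS.le, one_div_mul_cancel hpq.symm.ne_zero, Real.rpow_one]
    _ ≤ C ^ q := Real.rpow_le_rpow (Real.rpow_nonneg hS.le _) h1 hpq.symm.nonneg

section Duality
variable {H : Type*} [NormedAddCommGroup H] [InnerProductSpace ℂ H] [CompleteSpace H]
  {s t : ℕ} {Q : Matrix (Fin s) (Fin t) ℝ} {α β : Type*} {p q : ℝ}

theorem norm_sum_gramKernel_le_interp (hQ : IsSuborthogonal Q) {i : β → Fin s} {j : α → Fin t}
    {u v : α → H} {e f : β → H}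
    (hu : FiberwiseOrthonormal j u) (hv : FiberwiseOrthonormal j v)
    (he : FiberwiseOrthonormal i e) (hf : FiberwiseOrthonormal i f) (A : Finset α) (B : Finset β)
    (hpq : p.HolderConjugate q) (hp : p ≤ 2)
    {y : α → ℝ} (hy : ∀ a, 0 < y a) {z : β → ℝ} (hz : ∀ b ∈ B, 0 < z b) :
    ‖∑ b ∈ B, ∑ a ∈ A, (z b : ℂ) * y a * gramKernel Q i j u v e f b a‖ ≤
      maxAbsEntry Q ^ (2 / p - 1) * (∑ a ∈ A, y a ^ p) ^ (1 / p) *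
        (∑ k, (∑ b ∈ B with i b = k, z b ^ q) ^ (p / q)) ^ (1 / p) :=
  norm_bilinear_le_interp A B i _ (maxAbsEntry_nonneg Q)
    (fun a _ k => sum_norm_gramKernel_le hu hv he hf B a k)
    (fun z y => norm_sum_gramKernel_le hQ hu hv he hf A B z y) hpq hp hy hz

/-- The interpolated bilinear inequality, one argument being of finite rank. -/
theorem norm_sum_inner_le_of_mem_schattenClass (hQ : IsSuborthogonal Q)
    (hpq : p.HolderConjugate q) (hp : p ≤ 2) {Y : Fin t → H →L[ℂ] H}
    (hY : ∀ j, Y j ∈ schattenClass H p) {i : β → Fin s} {e f : β → H}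
    (he : FiberwiseOrthonormal i e) (hf : FiberwiseOrthonormal i f) (B : Finset β)
    {z : β → ℝ} (hz : ∀ b ∈ B, 0 < z b) :
    ‖∑ b ∈ B, (z b : ℂ) * ⟪e b, (∑ j, ((Q (i b) j : ℝ) : ℂ) • Y j) (f b)⟫_ℂ‖ ≤
      maxAbsEntry Q ^ (2 / p - 1) * (∑ j, schattenNorm p (Y j) ^ p) ^ (1 / p) *
        (∑ k, (∑ b ∈ B with i b = k, z b ^ q) ^ (p / q)) ^ (1 / p) := by
  choose u v hu hv _ hYs using fun j => exists_singularValueDecomposition (hY j).1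
  let y : (Σ j, SingularIndex (Y j)) → ℝ := fun a => a.2.1
  have hy : ∀ a, 0 < y a := fun a => a.2.1.2
  have hR : 0 ≤ ∑ k, (∑ b ∈ B with i b = k, z b ^ q) ^ (p / q) :=
    Finset.sum_nonneg fun k _ => Real.rpow_nonneg (Finset.sum_nonneg fun b hb =>
      Real.rpow_nonneg (hz b (Finset.mem_filter.1 hb).1).le _) _
  have hsum : HasSum (fun a => ∑ b ∈ B, (z b : ℂ) * y a *
      gramKernel Q i Sigma.fst (fun a => u a.1 a.2) (fun a => v a.1 a.2) e f b a)
      (∑ b ∈ B, (z b : ℂ) * ⟪e b, (∑ j, ((Q (i b) j : ℝ) : ℂ) • Y j) (f b)⟫_ℂ) := by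
    refine hasSum_sum fun b _ => ?_
    have hin : ⟪e b, (∑ j, ((Q (i b) j : ℝ) : ℂ) • Y j) (f b)⟫_ℂ =
        ∑ j, (Q (i b) j : ℂ) * ⟪e b, Y j (f b)⟫_ℂ := by
      rw [sum_apply, inner_sum]
      refine Finset.sum_congr rfl fun j _ => ?_
      rw [smul_apply, inner_smul_right]
    rw [hin, Finset.mul_sum]
    refine hasSum_sigma_fintype fun j => ?_
    refine (((hYs j (e b) (f b)).mul_left (Q (i b) j : ℂ)).mul_left (z b : ℂ)).congr_fun fun a => ?_
    simp only [gramKernel, y]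
    ring
  refine le_of_tendsto hsum.norm (Eventually.of_forall fun A => ?_)
  rw [Finset.sum_comm]
  refine (norm_sum_gramKernel_le_interp hQ (fiberwiseOrthonormal_sigma hu)
    (fiberwiseOrthonormal_sigma hv) he hf A B hpq hp hy hz).trans ?_
  refine mul_le_mul_of_nonneg_right (mul_le_mul_of_nonneg_left ?_
    (Real.rpow_nonneg (maxAbsEntry_nonneg Q) _)) (Real.rpow_nonneg hR _)
  refine Real.rpow_le_rpow (Finset.sum_nonneg fun a _ => Real.rpow_nonneg (hy a).le _) ?_
    (one_div_nonneg.2 hpq.nonneg)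
  exact sum_le_hasSum A (fun a _ => Real.rpow_nonneg (hy a).le _)
    (hasSum_sigma_fintype fun j => hasSum_schattenNorm hpq.pos (hY j))

/-- The interpolated bilinear inequality, the other argument being of finite rank. -/
theorem norm_sum_inner_transpose_le_of_mem_schattenClass (hQ : IsSuborthogonal Q)
    (hpq : p.HolderConjugate q) (hp : p ≤ 2) {Z : Fin s → H →L[ℂ] H}
    (hZ : ∀ i, Z i ∈ schattenClass H q) {j : α → Fin t} {u v : α → H}
    (hu : FiberwiseOrthonormal j u) (hv : FiberwiseOrthonormal j v) (A : Finset α)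
    {y : α → ℝ} (hy : ∀ a, 0 < y a) :
    ‖∑ a ∈ A, (y a : ℂ) * ⟪v a, (∑ i, ((Q i (j a) : ℝ) : ℂ) • Z i) (u a)⟫_ℂ‖ ≤
      maxAbsEntry Q ^ (2 / p - 1) * (∑ a ∈ A, y a ^ p) ^ (1 / p) *
        (∑ i, schattenNorm q (Z i) ^ p) ^ (1 / p) := by
  choose e f he hf _ hZs using fun i => exists_singularValueDecomposition (hZ i).1
  let z : (Σ i, SingularIndex (Z i)) → ℝ := fun b => b.2.1
  have hz : ∀ b, 0 < z b := fun b => b.2.1.2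
  have hP : 0 ≤ ∑ a ∈ A, y a ^ p := Finset.sum_nonneg fun a _ => Real.rpow_nonneg (hy a).le _
  have hG : ∀ B : Finset (Σ i, SingularIndex (Z i)), ∀ k,
      0 ≤ ∑ b ∈ B with b.1 = k, z b ^ q := fun B k =>
    Finset.sum_nonneg fun b _ => Real.rpow_nonneg (hz b).le _
  have hsum : HasSum (fun b => ∑ a ∈ A, (z b : ℂ) * y a *
      gramKernel Q Sigma.fst j u v (fun b => f b.1 b.2) (fun b => e b.1 b.2) b a)
      (∑ a ∈ A, (y a : ℂ) * ⟪v a, (∑ i, ((Q i (j a) : ℝ) : ℂ) • Z i) (u a)⟫_ℂ) := by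
    refine hasSum_sum fun a _ => ?_
    have hin : ⟪v a, (∑ i, ((Q i (j a) : ℝ) : ℂ) • Z i) (u a)⟫_ℂ =
        ∑ i, (Q i (j a) : ℂ) * ⟪v a, Z i (u a)⟫_ℂ := by
      rw [sum_apply, inner_sum]
      refine Finset.sum_congr rfl fun i _ => ?_
      rw [smul_apply, inner_smul_right]
    rw [hin, Finset.mul_sum]
    refine hasSum_sigma_fintype fun i => ?_
    refine (((hZs i (v a) (u a)).mul_left (Q i (j a) : ℂ)).mul_left (y a : ℂ)).congr_fun
      fun b => ?_
    simp only [gramKernel, z]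
    ring
  refine le_of_tendsto hsum.norm (Eventually.of_forall fun B => ?_)
  refine (norm_sum_gramKernel_le_interp hQ hu hv (fiberwiseOrthonormal_sigma hf)
    (fiberwiseOrthonormal_sigma he) A B hpq hp hy fun b _ => hz b).trans ?_
  refine mul_le_mul_of_nonneg_left ?_ (mul_nonneg (Real.rpow_nonneg (maxAbsEntry_nonneg Q) _)
    (Real.rpow_nonneg hP _))
  refine Real.rpow_le_rpow (Finset.sum_nonneg fun k _ => Real.rpow_nonneg (hG B k) _)
    (Finset.sum_le_sum fun k _ => ?_) (one_div_nonneg.2 hpq.nonneg)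
  calc (∑ b ∈ B with b.1 = k, z b ^ q) ^ (p / q)
      ≤ (schattenNorm q (Z k) ^ q) ^ (p / q) :=
        Real.rpow_le_rpow (hG B k) (sum_filter_sigma_le (fun b => Real.rpow_nonneg (hz b).le _)
          (hasSum_schattenNorm hpq.symm.pos (hZ k)) B) (div_nonneg hpq.nonneg hpq.symm.nonneg)
    _ = schattenNorm q (Z k) ^ p := by
        rw [← Real.rpow_mul (schattenNorm_nonneg q _), mul_div_cancel₀ _ hpq.symm.ne_zero]

theorem sum_schattenNorm_rpow_le (hQ : IsSuborthogonal Q) (hpq : p.HolderConjugate q)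
    (hp : p ≤ 2) {X : Fin s → H →L[ℂ] H} {Y : Fin t → H →L[ℂ] H}
    (hX : ∀ i, X i ∈ schattenClass H p) (hY : ∀ j, Y j ∈ schattenClass H p)
    (hXY : ∀ i, X i = ∑ j, ((Q i j : ℝ) : ℂ) • Y j) :
    ∑ i, schattenNorm p (X i) ^ q ≤
      maxAbsEntry Q ^ (q / p - 1) * (∑ j, schattenNorm p (Y j) ^ p) ^ (q / p) := by
  choose e f he hf hXf _ using fun i => exists_singularValueDecomposition (hX i).1
  let σ : (Σ i, SingularIndex (X i)) → ℝ := fun b => b.2.1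
  have hσ : ∀ b, 0 < σ b := fun b => b.2.1.2
  have hqp : q / p = q - 1 := by
    rw [div_eq_iff hpq.ne_zero, sub_mul, one_mul, mul_comm q p, hpq.mul_eq_add]; ring
  have hpq' : p / q = p - 1 := by
    rw [div_eq_iff hpq.symm.ne_zero, sub_mul, one_mul, hpq.mul_eq_add]; ring
  have hT : 0 ≤ ∑ j, schattenNorm p (Y j) ^ p :=
    Finset.sum_nonneg fun j _ => Real.rpow_nonneg (schattenNorm_nonneg p _) _
  have hlim : Tendsto (fun B : Finset (Σ i, SingularIndex (X i)) =>
      ∑ k, (∑ b ∈ B with b.1 = k, σ b ^ p) ^ (q / p)) atTop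
      (nhds (∑ k, schattenNorm p (X k) ^ q)) := by
    refine tendsto_finsetSum _ fun k _ => ?_
    have h := (tendsto_sum_filter_sigma (g := fun b => σ b ^ p)
      (hasSum_schattenNorm hpq.pos (hX k))).rpow_const
        (p := q / p) (Or.inr (div_nonneg hpq.symm.nonneg hpq.nonneg))
    rwa [← Real.rpow_mul (schattenNorm_nonneg p _), mul_div_cancel₀ _ hpq.ne_zero] at h
  refine le_of_tendsto hlim (Eventually.of_forall fun B => ?_)
  set G : Fin s → ℝ := fun k => ∑ b ∈ B with b.1 = k, σ b ^ p with hG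
  have hG0 : ∀ k, 0 ≤ G k := fun k =>
    Finset.sum_nonneg fun b _ => Real.rpow_nonneg (hσ b).le _
  have hGpos : ∀ b ∈ B, 0 < G b.1 := fun b hb =>
    Finset.sum_pos' (fun b _ => Real.rpow_nonneg (hσ b).le _)
      ⟨b, by simp [hb], Real.rpow_pos_of_pos (hσ b) _⟩
  have hGG : ∀ k, ∀ c : ℝ, c + 1 = q / p → G k ^ c * G k = G k ^ (q / p) := by
    intro k c hc
    rcases (hG0 k).eq_or_lt with h | h
    · rw [← h, mul_zero, Real.zero_rpow (div_pos hpq.symm.pos hpq.pos).ne']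
    · rw [← hc, Real.rpow_add_one h.ne']
  let z : (Σ i, SingularIndex (X i)) → ℝ := fun b => G b.1 ^ (q / p - 1) * σ b ^ (p - 1)
  have hz : ∀ b ∈ B, 0 < z b := fun b hb =>
    mul_pos (Real.rpow_pos_of_pos (hGpos b hb) _) (Real.rpow_pos_of_pos (hσ b) _)
  have key := norm_sum_inner_le_of_mem_schattenClass hQ hpq hp hY
    (fiberwiseOrthonormal_sigma he) (fiberwiseOrthonormal_sigma hf) B hz
  have hleft : ∑ b ∈ B, (z b : ℂ) * ⟪e b.1 b.2,
      (∑ j, ((Q b.1 j : ℝ) : ℂ) • Y j) (f b.1 b.2)⟫_ℂ = ((∑ k, G k ^ (q / p) : ℝ) : ℂ) := by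
    have h1 : ∀ b ∈ B, (z b : ℂ) * ⟪e b.1 b.2,
        (∑ j, ((Q b.1 j : ℝ) : ℂ) • Y j) (f b.1 b.2)⟫_ℂ =
          ((G b.1 ^ (q / p - 1) * σ b ^ p : ℝ) : ℂ) := by
      intro b _
      rw [← hXY, hXf, inner_smul_right, inner_self_eq_norm_sq_to_K, (he b.1).1 b.2]
      have : σ b ^ p = σ b ^ (p - 1) * σ b := by
        rw [← Real.rpow_add_one (hσ b).ne', sub_add_cancel]
      rw [this]
      simp only [z, σ]
      push_cast
      ring
    rw [Finset.sum_congr rfl h1, ← Complex.ofReal_sum, ← Finset.sum_fiberwise B Sigma.fst]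
    refine congrArg _ (Finset.sum_congr rfl fun k _ => ?_)
    rw [← hGG k (q / p - 1) (by ring), hG, Finset.mul_sum]
    exact Finset.sum_congr rfl fun b hb => by rw [(Finset.mem_filter.1 hb).2]
  have hright : ∀ k, (∑ b ∈ B with b.1 = k, z b ^ q) ^ (p / q) = G k ^ (q / p) := by
    intro k
    have h1 : ∀ b ∈ B.filter (·.1 = k), z b ^ q = G k ^ ((q / p - 1) * q) * σ b ^ p := by
      intro b hb
      simp only [z]
      rw [(Finset.mem_filter.1 hb).2, Real.mul_rpow (Real.rpow_nonneg (hG0 k) _)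
        (Real.rpow_nonneg (hσ b).le _), ← Real.rpow_mul (hG0 k), ← Real.rpow_mul (hσ b).le,
        show (p - 1) * q = p by rw [sub_mul, one_mul, hpq.mul_eq_add]; ring]
    rw [Finset.sum_congr rfl h1, ← Finset.mul_sum, Real.mul_rpow (Real.rpow_nonneg (hG0 k) _)
      (hG0 k), ← Real.rpow_mul (hG0 k)]
    change _ * G k ^ (p / q) = _
    rcases (hG0 k).eq_or_lt with h | h
    · rw [← h, Real.zero_rpow (div_pos hpq.pos hpq.symm.pos).ne', mul_zero,
        Real.zero_rpow (div_pos hpq.symm.pos hpq.pos).ne']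
    · rw [← Real.rpow_add h]
      congr 1
      have : q * (p / q) = p := mul_div_cancel₀ _ hpq.symm.ne_zero
      rw [mul_assoc, this, sub_mul, div_mul_cancel₀ _ hpq.ne_zero, hpq', hqp]
      ring
  have hS : 0 ≤ ∑ k, G k ^ (q / p) := Finset.sum_nonneg fun k _ => Real.rpow_nonneg (hG0 k) _
  rw [hleft, Finset.sum_congr rfl fun k _ => hright k, Complex.norm_real,
    Real.norm_of_nonneg hS] at key
  refine (le_rpow_of_le_mul_rpow hpq hS (mul_nonneg (Real.rpow_nonneg (maxAbsEntry_nonneg Q) _)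
    (Real.rpow_nonneg hT _)) key).trans (le_of_eq ?_)
  rw [Real.mul_rpow (Real.rpow_nonneg (maxAbsEntry_nonneg Q) _) (Real.rpow_nonneg hT _),
    ← Real.rpow_mul (maxAbsEntry_nonneg Q), ← Real.rpow_mul hT]
  congr 2
  · have : (2 / p - 1) * q = 2 * (q / p) - q := by ring
    rw [this, hqp]; ring
  · ring

theorem eq_sum_transpose_smul (hQ : IsSuborthogonal Q) {E : Type*} [AddCommGroup E] [Module ℂ E]
    {X : Fin s → E} {Y : Fin t → E} (hXY : ∀ i, X i = ∑ j, ((Q i j : ℝ) : ℂ) • Y j) (j : Fin t) :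
    Y j = ∑ i, ((Q i j : ℝ) : ℂ) • X i := by
  simp only [hXY, Finset.smul_sum, smul_smul]
  rw [Finset.sum_comm]
  simp only [← Finset.sum_smul, sum_mul_of_isSuborthogonal hQ, ite_smul, one_smul, zero_smul,
    Finset.sum_ite_eq, Finset.mem_univ, if_true]

theorem le_sum_schattenNorm_rpow (hQ : IsSuborthogonal Q) (hpq : p.HolderConjugate q)
    (hp : 2 ≤ p) {X : Fin s → H →L[ℂ] H} {Y : Fin t → H →L[ℂ] H}
    (hX : ∀ i, X i ∈ schattenClass H p) (hY : ∀ j, Y j ∈ schattenClass H p)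
    (hXY : ∀ i, X i = ∑ j, ((Q i j : ℝ) : ℂ) • Y j) :
    maxAbsEntry Q ^ (q / p - 1) * (∑ j, schattenNorm p (Y j) ^ p) ^ (q / p) ≤
      ∑ i, schattenNorm p (X i) ^ q := by
  have hp0 := hpq.pos
  have hq0 := hpq.symm.pos
  have hqp : q / p = q - 1 := by
    rw [div_eq_iff hpq.ne_zero, sub_mul, one_mul, mul_comm q p, hpq.mul_eq_add]; ring
  have hq : q ≤ 2 := by
    have : q / p * 2 ≤ q := by
      rw [div_mul_eq_mul_div, div_le_iff₀ hp0]
      exact mul_le_mul_of_nonneg_left hp hq0.le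
    linarith
  have hW : 0 ≤ ∑ i, schattenNorm p (X i) ^ q :=
    Finset.sum_nonneg fun i _ => Real.rpow_nonneg (schattenNorm_nonneg p _) _
  have hT : 0 ≤ ∑ j, schattenNorm p (Y j) ^ p :=
    Finset.sum_nonneg fun j _ => Real.rpow_nonneg (schattenNorm_nonneg p _) _
  rcases (maxAbsEntry_nonneg Q).eq_or_lt with hm | hm
  · have hQ0 : ∀ i j, Q i j = 0 := fun i j =>
      abs_nonpos_iff.1 ((abs_le_maxAbsEntry Q i j).trans hm.symm.le)
    have hempty : IsEmpty (Fin t) := ⟨fun j => by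
      have := sum_mul_of_isSuborthogonal hQ j j
      simp [hQ0] at this⟩
    rw [Finset.univ_eq_empty, Finset.sum_empty, Real.zero_rpow (div_pos hq0 hp0).ne', mul_zero]
    exact hW
  choose e f he hf hYf _ using fun j => exists_singularValueDecomposition (hY j).1
  let σ : (Σ j, SingularIndex (Y j)) → ℝ := fun a => a.2.1
  have hσ : ∀ a, 0 < σ a := fun a => a.2.1.2
  have hC : 0 ≤ maxAbsEntry Q ^ (2 / q - 1) * (∑ i, schattenNorm p (X i) ^ q) ^ (1 / q) :=
    mul_nonneg (Real.rpow_nonneg hm.le _) (Real.rpow_nonneg hW _)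
  have hle : ∑ j, schattenNorm p (Y j) ^ p ≤
      (maxAbsEntry Q ^ (2 / q - 1) * (∑ i, schattenNorm p (X i) ^ q) ^ (1 / q)) ^ p := by
    refine hasSum_le_of_sum_le (hasSum_sigma_fintype (g := fun a => σ a ^ p) fun j =>
      hasSum_schattenNorm hp0 (hY j)) fun A => ?_
    have key := norm_sum_inner_transpose_le_of_mem_schattenClass hQ hpq.symm hq hX
      (fiberwiseOrthonormal_sigma hf) (fiberwiseOrthonormal_sigma he) A
      (y := fun a => σ a ^ (p - 1)) fun a => Real.rpow_pos_of_pos (hσ a) _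
    have hleft : ∑ a ∈ A, ((σ a ^ (p - 1) : ℝ) : ℂ) * ⟪e a.1 a.2,
        (∑ i, ((Q i a.1 : ℝ) : ℂ) • X i) (f a.1 a.2)⟫_ℂ = ((∑ a ∈ A, σ a ^ p : ℝ) : ℂ) := by
      rw [Complex.ofReal_sum]
      refine Finset.sum_congr rfl fun a _ => ?_
      rw [← eq_sum_transpose_smul hQ hXY, hYf, inner_smul_right, inner_self_eq_norm_sq_to_K,
        (he a.1).1 a.2]
      have : σ a ^ p = σ a ^ (p - 1) * σ a := by
        rw [← Real.rpow_add_one (hσ a).ne', sub_add_cancel]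
      rw [this]
      simp [σ]
    have hright : ∑ a ∈ A, (σ a ^ (p - 1)) ^ q = ∑ a ∈ A, σ a ^ p :=
      Finset.sum_congr rfl fun a _ => by
        rw [← Real.rpow_mul (hσ a).le,
          show (p - 1) * q = p by rw [sub_mul, one_mul, hpq.mul_eq_add]; ring]
    have hS : 0 ≤ ∑ a ∈ A, σ a ^ p := Finset.sum_nonneg fun a _ => Real.rpow_nonneg (hσ a).le _
    rw [hleft, hright, Complex.norm_real, Real.norm_of_nonneg hS, mul_right_comm] at key
    exact le_rpow_of_le_mul_rpow hpq.symm hS hC key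
  have hpow := Real.rpow_le_rpow hT hle (div_nonneg hq0.le hp0.le : 0 ≤ q / p)
  rw [← Real.rpow_mul hC, mul_div_cancel₀ _ hp0.ne',
    Real.mul_rpow (Real.rpow_nonneg hm.le _) (Real.rpow_nonneg hW _), ← Real.rpow_mul hm.le,
    ← Real.rpow_mul hW, one_div_mul_cancel hq0.ne', Real.rpow_one] at hpow
  refine (mul_le_mul_of_nonneg_left hpow (Real.rpow_nonneg hm.le _)).trans (le_of_eq ?_)
  rw [← mul_assoc, ← Real.rpow_add hm]
  have : q / p - 1 + (2 / q - 1) * q = 0 := by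
    rw [hqp, sub_mul, div_mul_cancel₀ _ hq0.ne']; ring
  rw [this, Real.rpow_zero, one_mul]
end Duality

theorem mainTheorem11 {H : Type*} [NormedAddCommGroup H] [InnerProductSpace ℂ H]
    [CompleteSpace H] {s t : ℕ} (Q : Matrix (Fin s) (Fin t) ℝ) (hQ : IsSuborthogonal Q)
    (p q : ℝ) (hpq : p.HolderConjugate q)
    (X : Fin s → H →L[ℂ] H) (Y : Fin t → H →L[ℂ] H)
    (hX : ∀ i, X i ∈ schattenClass H p) (hY : ∀ j, Y j ∈ schattenClass H p)
    (hXY : ∀ i, X i = ∑ j, ((Q i j : ℝ) : ℂ) • Y j) :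
    (p ≤ 2 →
      ∑ i, schattenNorm p (X i) ^ q ≤
        maxAbsEntry Q ^ (q / p - 1) * (∑ j, schattenNorm p (Y j) ^ p) ^ (q / p)) ∧
    (2 ≤ p →
      maxAbsEntry Q ^ (q / p - 1) * (∑ j, schattenNorm p (Y j) ^ p) ^ (q / p) ≤
        ∑ i, schattenNorm p (X i) ^ q) :=
  ⟨fun hp => sum_schattenNorm_rpow_le hQ hpq hp hX hY hXY,
    fun hp => le_sum_schattenNorm_rpow hQ hpq hp hX hY hXY⟩
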